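/- Let $n\ge 0$ be an integer and let $u:\{-n,\dots,n\}\to\mathbb{R}$ be symmetric ($u(-k)=u(k)$ for all $k$) with $\sum_{k=-n}^n u(k)=1$. For $f\in\ell^2(\mathbb{Z})$ (real- or complex-valued) put $(f*u)(j)=\sum_{k=-n}^n f(j-k)u(k)$ and $(\nabla g)(k)=g(k+1)-g(k)$. Then $f\mapsto\nabla(f*u)$ maps $\ell^2(\mathbb{Z})$ boundedly into itself, and $$\sup_{0\ne f\in\ell^2(\mathbb{Z})}\frac{\|\nabla(f*u)\|_{\ell^2(\mathbb{Z})}}{\|f\|_{\ell^2(\mathbb{Z})}}\ \ge\ \frac{2}{2n+1},$$ with equality if and only if $u$ is the constant function $u(k)=1/(2n+1)$. This holds both when the supremum is taken over real-valued $f$ and when it is taken over complex-valued $f$. -/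

import Mathlib

open scoped ENNReal

namespace SmoothAveraging

/-- The window `{-n, …, n}` of integers. -/
abbrev Window (n : ℕ) : Type := ↥(Finset.Icc (-(n : ℤ)) (n : ℤ))

/-- A function on `{-n, …, n}` is symmetric (even) if `u (-k) = u k` for all `k`. -/
def IsSymmetric {n : ℕ} (u : Window n → ℝ) : Prop :=
  ∀ j k : Window n, (j : ℤ) = -(k : ℤ) → u j = u k

/-- The Hilbert space `ℓ²(ℤ)` with scalars `𝕜` (real or complex). -/
abbrev EllTwo (𝕜 : Type*) [RCLike 𝕜] : Type _ := lp (fun _ : ℤ => 𝕜) 2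

/-- The convolution `(f * u)(j) = ∑ k, f (j - k) u k`, the sum running over `{-n, …, n}`. -/
noncomputable def conv {𝕜 : Type*} [RCLike 𝕜] {n : ℕ} (f : ℤ → 𝕜) (u : Window n → ℝ) : ℤ → 𝕜 :=
  fun j => ∑ k : Window n, f (j - (k : ℤ)) * (u k : 𝕜)

/-- The discrete derivative `(∇ f)(k) = f (k + 1) - f k`. -/
def grad {𝕜 : Type*} [RCLike 𝕜] (f : ℤ → 𝕜) : ℤ → 𝕜 :=
  fun k => f (k + 1) - f k

theorem memℓp_translate {𝕜 : Type*} [RCLike 𝕜] {f : ℤ → 𝕜}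
    (hf : Memℓp f 2) (m : ℤ) : Memℓp (fun k => f (k + m)) 2 := by
  have h2 : 0 < (2 : ℝ≥0∞).toReal := by norm_num
  rw [memℓp_gen_iff h2] at hf ⊢
  exact (Equiv.addRight m).summable_iff.mpr hf

theorem memℓp_conv {𝕜 : Type*} [RCLike 𝕜] {n : ℕ} {f : ℤ → 𝕜}
    (hf : Memℓp f 2) (u : Window n → ℝ) : Memℓp (conv f u) 2 := by
  refine Memℓp.finsetSum Finset.univ
    (f := fun (k : Window n) (j : ℤ) => f (j - (k : ℤ)) * (u k : 𝕜)) ?_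
  intro k _
  have h := (memℓp_translate hf (-(k : ℤ))).const_mul (u k : 𝕜)
  simpa only [mul_comm, sub_eq_add_neg] using h

theorem memℓp_grad {𝕜 : Type*} [RCLike 𝕜] {f : ℤ → 𝕜}
    (hf : Memℓp f 2) : Memℓp (grad f) 2 :=
  (memℓp_translate hf 1).sub hf

/-- The map `f ↦ ∇ (f * u)` from `ℓ²(ℤ)` to `ℓ²(ℤ)`. -/
noncomputable def gradConv {𝕜 : Type*} [RCLike 𝕜] {n : ℕ} (u : Window n → ℝ) (f : EllTwo 𝕜) : EllTwo 𝕜 :=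
  ⟨grad (conv (f : ℤ → 𝕜) u), memℓp_grad (memℓp_conv (lp.memℓp f) u)⟩

/-- The set of ratios `‖∇ (f * u)‖ / ‖f‖` over all nonzero `f` in `ℓ²(ℤ)`. -/
def ratios (𝕜 : Type*) [RCLike 𝕜] {n : ℕ} (u : Window n → ℝ) : Set ℝ :=
  {r | ∃ f : EllTwo 𝕜, f ≠ 0 ∧ r = ‖gradConv u f‖ / ‖f‖}

end SmoothAveraging

/-!
Convolution with `u` multiplies the character `j ↦ zʲ` by the symbol `û z = ∑ k, u k z⁻ᵏ`, so
testing on truncated characters shows that the norm of `f ↦ ∇ (f * u)` is at least `|z - 1| |û z|`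
for every `z` on the unit circle. There `|z - 1|² |û z|² = 2 (1 - x) W(x)` with `x = Re z` and `W` a
real polynomial of degree at most `2n` with `W(1) = (∑ k, u k)² = 1`. If `|z - 1| |û z| ≤ c`, the
polynomial `R(x) = 1 - (4 / c²) (1 - x) W(x)` maps `[-1, 1]` to itself, and Markov's inequality at
the endpoint gives `4 / c² = R'(1) ≤ T'(1) = (2n + 1)²` for the Chebyshev polynomial `T` of degree
`2n + 1`. Equality forces `R = T`, hence `û = 0` at all nontrivial `(2n + 1)`-th roots of unity,
hence `u` is constant. For constant `u` the sum defining `∇ (f * u)` telescopes to a multiple of the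
difference of two translates of `f`.
-/

namespace SmoothAveraging

open Polynomial

section Polynomial

theorem eval_T_re_of_norm_eq_one {z : ℂ} (hz : ‖z‖ = 1) (k : ℤ) :
    (Chebyshev.T ℝ k).eval z.re = (z ^ k).re := by
  obtain ⟨θ, rfl⟩ := (Complex.norm_eq_one_iff z).mp hz
  have hpow : Complex.exp (θ * Complex.I) ^ k = Complex.exp ((k * θ : ℝ) * Complex.I) := by
    rw [← Complex.exp_int_mul]
    push_cast
    ring_nf
  rw [hpow, Complex.exp_ofReal_mul_I_re, Complex.exp_ofReal_mul_I_re, Chebyshev.T_real_cos]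

variable {m : ℕ} {W : ℝ[X]}

theorem degree_one_sub_one_sub_X_mul_le (hW : W.natDegree ≤ m) :
    (1 - (1 - X) * W).degree ≤ ((m + 1 : ℕ) : WithBot ℕ) := by
  refine degree_le_of_natDegree_le ?_
  compute_degree
  omega

theorem eval_derivative_one_sub_one_sub_X_mul (W : ℝ[X]) :
    (derivative^[1] (1 - (1 - X) * W)).eval 1 = W.eval 1 := by
  simp

theorem eval_iterate_derivative_T_one (m : ℕ) :
    (derivative^[1] (Chebyshev.T ℝ (m + 1 : ℕ))).eval 1 = ((m : ℝ) + 1) ^ 2 := by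
  simp [Chebyshev.derivative_T_eval_one]

theorem abs_eval_one_sub_one_sub_X_mul_le
    (hbound : ∀ x ∈ Set.Icc (-1 : ℝ) 1, (1 - x) * W.eval x ∈ Set.Icc 0 2) :
    ∀ x ∈ Set.Icc (-1 : ℝ) 1, |(1 - (1 - X) * W).eval x| ≤ 1 := by
  intro x hx
  obtain ⟨hnonneg, hle⟩ := hbound x hx
  simp only [eval_sub, eval_mul, eval_one, eval_X]
  rw [abs_le]
  constructor <;> linarith

theorem eval_one_le_sq_of_one_sub_mul_mem_Icc (hW : W.natDegree ≤ m)
    (hbound : ∀ x ∈ Set.Icc (-1 : ℝ) 1, (1 - x) * W.eval x ∈ Set.Icc 0 2) :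
    W.eval 1 ≤ ((m : ℝ) + 1) ^ 2 := by
  rw [← eval_derivative_one_sub_one_sub_X_mul, ← eval_iterate_derivative_T_one]
  exact Chebyshev.eval_iterate_derivative_le_of_forall_abs_le_one le_rfl
    (degree_one_sub_one_sub_X_mul_le hW) (abs_eval_one_sub_one_sub_X_mul_le hbound)

theorem eval_one_eq_sq_iff_of_one_sub_mul_mem_Icc (hW : W.natDegree ≤ m)
    (hbound : ∀ x ∈ Set.Icc (-1 : ℝ) 1, (1 - x) * W.eval x ∈ Set.Icc 0 2) :
    W.eval 1 = ((m : ℝ) + 1) ^ 2 ↔ 1 - (1 - X) * W = Chebyshev.T ℝ (m + 1 : ℕ) := by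
  rw [← eval_derivative_one_sub_one_sub_X_mul, ← eval_iterate_derivative_T_one]
  exact Chebyshev.eval_iterate_derivative_eq_iff_of_bounded one_pos (Nat.le_add_left 1 m) le_rfl
    (degree_one_sub_one_sub_X_mul_le hW) (abs_eval_one_sub_one_sub_X_mul_le hbound)

theorem natCast_mul_coeff_eq_eval_one {R : Type*} [CommRing R] [IsDomain R] {N : ℕ} {ζ : R}
    (hζ : IsPrimitiveRoot ζ N) {p : R[X]} (hp : p.degree < N)
    (hroot : ∀ z : R, z ^ N = 1 → z ≠ 1 → p.eval z = 0) {i : ℕ} (hi : i < N) :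
    (N : R) * p.coeff i = p.eval 1 := by
  have hgeom : (p.eval 1 • ∑ j ∈ Finset.range N, X ^ j : R[X]).degree < N := by
    refine (degree_smul_le _ _).trans_lt <| (degree_lt_iff_coeff_zero _ _).mpr fun j hj => ?_
    simp [finsetSum_coeff, coeff_X_pow, hj]
  have heq : (N : R) • p = p.eval 1 • ∑ j ∈ Finset.range N, X ^ j := by
    refine eq_of_degrees_lt_of_eval_finset_eq (nthRootsFinset N (1 : R)) ?_ ?_ fun z hz => ?_
    · rw [hζ.card_nthRootsFinset]
      exact (degree_smul_le _ _).trans_lt hp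
    · rwa [hζ.card_nthRootsFinset]
    · rw [mem_nthRootsFinset (by omega)] at hz
      simp only [eval_smul, smul_eq_mul, eval_finsetSum, eval_pow, eval_X]
      rcases eq_or_ne z 1 with rfl | hne
      · simp [mul_comm]
      · have hsum : ∑ j ∈ Finset.range N, z ^ j = 0 := by
          refine (mul_eq_zero_iff_right (sub_ne_zero.mpr hne)).mp ?_
          rw [geom_sum_mul, hz, sub_self]
        rw [hroot z hz hne, hsum, mul_zero, mul_zero]
  have hcoeff := congrArg (fun q : R[X] => q.coeff i) heq
  simpa [finsetSum_coeff, coeff_X_pow, hi] using hcoeff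

end Polynomial

section Symbol

variable {n : ℕ}

/-- The Fourier series `∑ k, u k z⁻ᵏ` of a kernel. Convolution with `u` multiplies the character
`j ↦ zʲ` by `symbol u z`. -/
noncomputable def symbol (u : Window n → ℝ) (z : ℂ) : ℂ :=
  ∑ k : Window n, (u k : ℂ) * z ^ (-(k : ℤ))

/-- The power spectrum `|∑ k, u k z⁻ᵏ|²` on the unit circle, as a polynomial in `z.re`. -/
noncomputable def powerSpectrum (u : Window n → ℝ) : ℝ[X] :=
  ∑ j : Window n, ∑ k : Window n, C (u j * u k) * Chebyshev.T ℝ ((j : ℤ) - k)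

/-- The polynomial `zⁿ * symbol u z`; no exponent `n - k` is truncated, since `k ≤ n`. -/
noncomputable def symbolPolynomial (u : Window n → ℝ) : ℂ[X] :=
  ∑ k : Window n, C (u k : ℂ) * X ^ ((n : ℤ) - k).toNat

theorem natDegree_powerSpectrum_le (u : Window n → ℝ) : (powerSpectrum u).natDegree ≤ 2 * n := by
  refine natDegree_sum_le_of_forall_le _ _ fun j _ =>
    natDegree_sum_le_of_forall_le _ _ fun k _ => ?_
  refine (natDegree_C_mul_le _ _).trans ?_
  rw [Chebyshev.natDegree_T]
  have hj := Finset.mem_Icc.mp j.2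
  have hk := Finset.mem_Icc.mp k.2
  omega

theorem eval_one_powerSpectrum (u : Window n → ℝ) : (powerSpectrum u).eval 1 = (∑ k, u k) ^ 2 := by
  simp [powerSpectrum, eval_finsetSum, sq, Finset.sum_mul_sum]

theorem eval_re_powerSpectrum (u : Window n → ℝ) {z : ℂ} (hz : ‖z‖ = 1) :
    (powerSpectrum u).eval z.re = ‖symbol u z‖ ^ 2 := by
  have hz0 : z ≠ 0 := norm_ne_zero_iff.mp (hz ▸ one_ne_zero)
  have hconj : (starRingEnd ℂ) z = z⁻¹ := (Complex.inv_eq_conj hz).symm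
  have hsq : (‖symbol u z‖ ^ 2 : ℝ) =
      (∑ j : Window n, ∑ k : Window n, ((u j * u k : ℝ) : ℂ) * z ^ ((k : ℤ) - j)).re := by
    rw [← Complex.ofReal_re (‖symbol u z‖ ^ 2), Complex.ofReal_pow, ← Complex.mul_conj', symbol,
      map_sum, Finset.sum_mul_sum]
    simp only [map_mul, Complex.conj_ofReal, map_zpow₀, hconj, inv_zpow', neg_neg]
    refine congrArg Complex.re <|
      Finset.sum_congr rfl fun j _ => Finset.sum_congr rfl fun k _ => ?_
    rw [sub_eq_add_neg, zpow_add₀ hz0, Complex.ofReal_mul]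
    ring
  rw [hsq, powerSpectrum, Finset.sum_comm]
  simp [eval_finsetSum, eval_T_re_of_norm_eq_one hz, mul_comm]

theorem norm_sub_one_mul_symbol_sq (u : Window n → ℝ) {z : ℂ} (hz : ‖z‖ = 1) :
    ‖(z - 1) * symbol u z‖ ^ 2 = 2 * ((1 - z.re) * (powerSpectrum u).eval z.re) := by
  have hsub : ‖z - 1‖ ^ 2 = 2 * (1 - z.re) := by
    have hnorm : z.re * z.re + z.im * z.im = 1 := by
      rw [← Complex.normSq_apply, ← Complex.sq_norm, hz, one_pow]
    rw [Complex.sq_norm, Complex.normSq_apply, Complex.sub_re, Complex.sub_im, Complex.one_re,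
      Complex.one_im]
    linear_combination hnorm
  rw [norm_mul, mul_pow, hsub, eval_re_powerSpectrum u hz, mul_assoc]

theorem exists_norm_eq_one_re_eq {x : ℝ} (hx : x ∈ Set.Icc (-1) 1) : ∃ z : ℂ, ‖z‖ = 1 ∧ z.re = x :=
  ⟨Complex.exp (Real.arccos x * Complex.I), Complex.norm_exp_ofReal_mul_I _, by
    rw [Complex.exp_ofReal_mul_I_re, Real.cos_arccos hx.1 hx.2]⟩

theorem one_sub_mul_eval_powerSpectrum_mem_Icc {u : Window n → ℝ} {c : ℝ} (hc : 0 < c)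
    (hbound : ∀ z : ℂ, ‖z‖ = 1 → ‖(z - 1) * symbol u z‖ ≤ c) :
    ∀ x ∈ Set.Icc (-1 : ℝ) 1,
      (1 - x) * (C (4 / c ^ 2) * powerSpectrum u).eval x ∈ Set.Icc 0 2 := by
  intro x hx
  obtain ⟨z, hz, rfl⟩ := exists_norm_eq_one_re_eq hx
  have hscale : (1 - z.re) * (C (4 / c ^ 2) * powerSpectrum u).eval z.re =
      2 * (‖(z - 1) * symbol u z‖ / c) ^ 2 := by
    rw [eval_mul, eval_C, div_pow, norm_sub_one_mul_symbol_sq u hz]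
    ring
  have hratio : ‖(z - 1) * symbol u z‖ / c ≤ 1 := (div_le_one₀ hc).mpr (hbound z hz)
  rw [hscale]
  exact ⟨by positivity, by nlinarith [pow_le_one₀ (n := 2) (by positivity) hratio]⟩

theorem two_div_le_of_norm_sub_one_mul_symbol_le {u : Window n → ℝ} (hsum : ∑ k, u k = 1)
    {c : ℝ} (hc : 0 < c) (hbound : ∀ z : ℂ, ‖z‖ = 1 → ‖(z - 1) * symbol u z‖ ≤ c) :
    2 / (2 * (n : ℝ) + 1) ≤ c := by
  have hle := eval_one_le_sq_of_one_sub_mul_mem_Icc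
    ((natDegree_C_mul_le _ _).trans (natDegree_powerSpectrum_le u))
    (one_sub_mul_eval_powerSpectrum_mem_Icc hc hbound)
  rw [eval_mul, eval_C, eval_one_powerSpectrum, hsum, one_pow, mul_one] at hle
  have hsq : (2 / c) ^ 2 ≤ (2 * (n : ℝ) + 1) ^ 2 := by
    convert hle using 1
    · ring
    · push_cast
      ring
  exact (div_le_comm₀ hc (by positivity)).mp (le_of_sq_le_sq hsq (by positivity))

theorem symbol_eq_zero_of_norm_sub_one_mul_symbol_le {u : Window n → ℝ} (hsum : ∑ k, u k = 1)
    (hbound : ∀ z : ℂ, ‖z‖ = 1 → ‖(z - 1) * symbol u z‖ ≤ 2 / (2 * (n : ℝ) + 1))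
    {z : ℂ} (hz : z ^ (2 * n + 1) = 1) (hz1 : z ≠ 1) : symbol u z = 0 := by
  have hN : (0 : ℝ) < 2 / (2 * n + 1) := by positivity
  have hnorm : ‖z‖ = 1 := Complex.norm_eq_one_of_pow_eq_one hz (Nat.succ_ne_zero _)
  have hT := (eval_one_eq_sq_iff_of_one_sub_mul_mem_Icc
    ((natDegree_C_mul_le _ _).trans (natDegree_powerSpectrum_le u))
    (one_sub_mul_eval_powerSpectrum_mem_Icc hN hbound)).mp <| by
      rw [eval_mul, eval_C, eval_one_powerSpectrum, hsum]
      push_cast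
      field_simp
      norm_num
  have heval := congrArg (eval z.re) hT
  rw [eval_T_re_of_norm_eq_one hnorm, zpow_natCast, hz, eval_sub, eval_one, Complex.one_re,
    sub_eq_self, mul_left_comm, eval_mul, eval_C, mul_eq_zero_iff_left (by positivity), eval_mul,
    eval_sub, eval_one, eval_X] at heval
  have hzero : (z - 1) * symbol u z = 0 := by
    rw [← norm_eq_zero, ← sq_eq_zero_iff, norm_sub_one_mul_symbol_sq u hnorm, heval, mul_zero]
  exact (mul_eq_zero_iff_left (sub_ne_zero.mpr hz1)).mp hzero

theorem degree_symbolPolynomial_lt (u : Window n → ℝ) :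
    (symbolPolynomial u).degree < (2 * n + 1 : ℕ) := by
  refine (degree_sum_le _ _).trans_lt ((Finset.sup_lt_iff (WithBot.bot_lt_coe _)).mpr fun k _ => ?_)
  refine (degree_C_mul_X_pow_le _ _).trans_lt (Nat.cast_lt.mpr ?_)
  have hk := Finset.mem_Icc.mp k.2
  omega

theorem coeff_symbolPolynomial (u : Window n → ℝ) (k : Window n) :
    (symbolPolynomial u).coeff ((n : ℤ) - k).toNat = u k := by
  rw [symbolPolynomial, finsetSum_coeff, Finset.sum_eq_single k]
  · simp
  · intro j _ hjk
    have hj := Finset.mem_Icc.mp j.2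
    have hk := Finset.mem_Icc.mp k.2
    have hne : (j : ℤ) ≠ k := Subtype.coe_ne_coe.mpr hjk
    rw [coeff_C_mul, coeff_X_pow, if_neg (by omega), mul_zero]
  · simp

theorem eval_symbolPolynomial (u : Window n → ℝ) {z : ℂ} (hz : z ≠ 0) :
    (symbolPolynomial u).eval z = z ^ n * symbol u z := by
  simp only [symbolPolynomial, symbol, eval_finsetSum, eval_mul, eval_C, eval_pow, eval_X,
    Finset.mul_sum]
  refine Finset.sum_congr rfl fun k _ => ?_
  have hk := Finset.mem_Icc.mp k.2
  rw [← zpow_natCast z (Int.toNat _), Int.toNat_of_nonneg (by omega), sub_eq_add_neg,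
    zpow_add₀ hz, zpow_natCast]
  ring

theorem eq_const_of_symbol_eq_zero {u : Window n → ℝ} (hsum : ∑ k, u k = 1)
    (hzero : ∀ z : ℂ, z ^ (2 * n + 1) = 1 → z ≠ 1 → symbol u z = 0) (k : Window n) :
    u k = 1 / (2 * (n : ℝ) + 1) := by
  have hk := Finset.mem_Icc.mp k.2
  have hcoeff := natCast_mul_coeff_eq_eval_one
    (Complex.isPrimitiveRoot_exp (2 * n + 1) (Nat.succ_ne_zero _)) (degree_symbolPolynomial_lt u)
    (fun z hz hz1 => by
      rw [eval_symbolPolynomial u (IsUnit.of_pow_eq_one hz (Nat.succ_ne_zero _)).ne_zero,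
        hzero z hz hz1, mul_zero])
    (show ((n : ℤ) - k).toNat < 2 * n + 1 by omega)
  have hone : symbol u 1 = 1 := by
    simp only [symbol, one_zpow, mul_one]
    exact_mod_cast hsum
  rw [coeff_symbolPolynomial, eval_symbolPolynomial u one_ne_zero, hone, one_pow, mul_one] at hcoeff
  rw [eq_div_iff (by positivity), mul_comm]
  exact_mod_cast hcoeff

end Symbol

section Operator

variable {𝕜 : Type*} [RCLike 𝕜] {n : ℕ}

theorem norm_sq_eq_tsum (f : EllTwo 𝕜) : ‖f‖ ^ 2 = ∑' j, ‖f j‖ ^ 2 := by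
  simpa using lp.norm_rpow_eq_tsum (by norm_num) f

theorem sum_norm_sq_le_norm_sq (f : EllTwo 𝕜) (s : Finset ℤ) :
    ∑ j ∈ s, ‖f j‖ ^ 2 ≤ ‖f‖ ^ 2 := by
  simpa using lp.sum_rpow_le_norm_rpow (by norm_num) f s

variable (𝕜) in
/-- The translation `f ↦ f (· + m)` as a linear isometry of `ℓ²(ℤ)`. -/
noncomputable def translate (m : ℤ) : EllTwo 𝕜 →ₗᵢ[𝕜] EllTwo 𝕜 where
  toFun f := ⟨fun j => f (j + m), memℓp_translate (lp.memℓp f) m⟩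
  map_add' _ _ := rfl
  map_smul' _ _ := rfl
  norm_map' f := by
    refine (pow_left_inj₀ (norm_nonneg _) (norm_nonneg _) two_ne_zero).mp ?_
    rw [norm_sq_eq_tsum, norm_sq_eq_tsum]
    exact (Equiv.addRight m).tsum_eq fun j => ‖f j‖ ^ 2

variable (𝕜) in
/-- The map `gradConv u` as a bounded operator, in terms of translations. -/
noncomputable def gradConvCLM (u : Window n → ℝ) : EllTwo 𝕜 →L[𝕜] EllTwo 𝕜 :=
  ∑ k : Window n, (u k : 𝕜) • ((translate 𝕜 (1 - k)).toContinuousLinearMap -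
    (translate 𝕜 (-k)).toContinuousLinearMap)

theorem gradConvCLM_apply (u : Window n → ℝ) (f : EllTwo 𝕜) : gradConvCLM 𝕜 u f = gradConv u f := by
  ext j
  rw [gradConvCLM, sum_apply, lp.coeFn_sum, Finset.sum_apply]
  change ∑ k : Window n, (u k : 𝕜) * (f (j + (1 - k)) - f (j + -k)) =
    ∑ k : Window n, f (j + 1 - k) * (u k : 𝕜) - ∑ k : Window n, f (j - k) * (u k : 𝕜)
  rw [← Finset.sum_sub_distrib]
  refine Finset.sum_congr rfl fun k _ => ?_
  rw [add_sub_assoc, sub_eq_add_neg j]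
  ring

theorem norm_gradConv_le_opNorm (u : Window n → ℝ) (f : EllTwo 𝕜) :
    ‖gradConv u f‖ ≤ ‖gradConvCLM 𝕜 u‖ * ‖f‖ :=
  gradConvCLM_apply u f ▸ (gradConvCLM 𝕜 u).le_opNorm f

theorem nonempty_ratios (u : Window n → ℝ) : (ratios 𝕜 u).Nonempty := by
  refine ⟨_, lp.single 2 0 1, fun h => one_ne_zero (α := 𝕜) ?_, rfl⟩
  simpa using congrArg (fun f : EllTwo 𝕜 => f 0) h

theorem isLUB_ratios (u : Window n → ℝ) : IsLUB (ratios 𝕜 u) ‖gradConvCLM 𝕜 u‖ := by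
  constructor
  · rintro _ ⟨f, -, rfl⟩
    exact div_le_of_le_mul₀ (norm_nonneg f) (norm_nonneg _) (norm_gradConv_le_opNorm u f)
  · intro c hc
    have hratio : ∀ f : EllTwo 𝕜, f ≠ 0 → ‖gradConv u f‖ / ‖f‖ ≤ c := fun f hf => hc ⟨f, hf, rfl⟩
    obtain ⟨_, g, hg, -⟩ := nonempty_ratios (𝕜 := 𝕜) u
    have hc0 : 0 ≤ c := (by positivity : 0 ≤ ‖gradConv u g‖ / ‖g‖).trans (hratio g hg)
    refine ContinuousLinearMap.opNorm_le_bound' _ hc0 fun f hf => ?_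
    rw [gradConvCLM_apply]
    exact (div_le_iff₀ (hf.symm.lt_of_le (norm_nonneg f))).mp (hratio f (norm_ne_zero_iff.mp hf))

theorem sum_Icc_sub_telescope {M : Type*} [AddCommGroup M] (g : ℤ → M) (n : ℕ) :
    ∑ k ∈ Finset.Icc (-n : ℤ) n, (g (1 - k) - g (-k)) = g (n + 1) - g (-n) := by
  induction n with
  | zero => simp
  | succ n ih =>
    rw [Nat.cast_succ, Finset.sum_Icc_succ_eq_add_endpoints, ih, show 1 - (n + 1 : ℤ) = -n by ring,
      show 1 - -(n + 1 : ℤ) = n + 1 + 1 by ring, neg_neg]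
    abel

theorem gradConvCLM_of_const {u : Window n → ℝ} {c : ℝ} (hu : ∀ k, u k = c) :
    gradConvCLM 𝕜 u = (c : 𝕜) • ((translate 𝕜 (n + 1)).toContinuousLinearMap -
      (translate 𝕜 (-n)).toContinuousLinearMap) := by
  rw [← sum_Icc_sub_telescope (fun m => (translate 𝕜 m).toContinuousLinearMap), Finset.smul_sum,
    ← Finset.sum_coe_sort, gradConvCLM]
  simp only [hu]

theorem norm_gradConvCLM_le_of_const {u : Window n → ℝ} {c : ℝ} (hu : ∀ k, u k = c) :
    ‖gradConvCLM 𝕜 u‖ ≤ 2 * |c| := by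
  have htranslate : ∀ m, ‖(translate 𝕜 m).toContinuousLinearMap‖ ≤ 1 := fun m =>
    (translate 𝕜 m).norm_toContinuousLinearMap_le
  rw [gradConvCLM_of_const hu, norm_smul, RCLike.norm_ofReal, mul_comm]
  gcongr
  exact (norm_sub_le_of_le (htranslate _) (htranslate _)).trans_eq one_add_one_eq_two

theorem sum_norm_sq_grad_conv_le (u : Window n → ℝ) (f : ℤ → 𝕜) (M : ℕ) :
    ∑ j ∈ Finset.Ico (0 : ℤ) M, ‖grad (conv f u) j‖ ^ 2 ≤
      ‖gradConvCLM 𝕜 u‖ ^ 2 * ∑ j ∈ Finset.Ico (-n : ℤ) (M + n + 1), ‖f j‖ ^ 2 := by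
  set s := Finset.Ico (-n : ℤ) (M + n + 1) with hs
  let g : EllTwo 𝕜 := ∑ i ∈ s, lp.single 2 i (f i)
  have hg : ∀ j ∈ s, g j = f j := by
    intro j hj
    simp only [g, lp.coeFn_sum, lp.coeFn_single, Finset.sum_apply, Finset.sum_pi_single, if_pos hj]
  have hnorm : ‖g‖ ^ 2 = ∑ j ∈ s, ‖f j‖ ^ 2 := by
    simpa [g] using lp.norm_sum_single (p := 2) (by norm_num) f s
  have hlocal : ∀ j ∈ Finset.Ico (0 : ℤ) M, gradConv u g j = grad (conv f u) j := by
    intro j hj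
    rw [Finset.mem_Ico] at hj
    have hwindow : ∀ k : Window n, g (j + 1 - k) = f (j + 1 - k) ∧ g (j - k) = f (j - k) := by
      intro k
      have hk := Finset.mem_Icc.mp k.2
      constructor <;> exact hg _ (by rw [hs, Finset.mem_Ico]; omega)
    simp only [gradConv, grad, conv, hwindow]
  calc ∑ j ∈ Finset.Ico (0 : ℤ) M, ‖grad (conv f u) j‖ ^ 2
      = ∑ j ∈ Finset.Ico (0 : ℤ) M, ‖gradConv u g j‖ ^ 2 :=
        Finset.sum_congr rfl fun j hj => by rw [hlocal j hj]
    _ ≤ ‖gradConv u g‖ ^ 2 := sum_norm_sq_le_norm_sq _ _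
    _ ≤ (‖gradConvCLM 𝕜 u‖ * ‖g‖) ^ 2 := by gcongr; exact norm_gradConv_le_opNorm u g
    _ = ‖gradConvCLM 𝕜 u‖ ^ 2 * ∑ j ∈ s, ‖f j‖ ^ 2 := by rw [mul_pow, hnorm]

theorem grad_conv_ofReal (u : Window n → ℝ) (g : ℤ → ℝ) (j : ℤ) :
    grad (conv (fun i => (g i : 𝕜)) u) j = ((grad (conv g u) j : ℝ) : 𝕜) := by
  simp [grad, conv]

theorem re_grad_conv (u : Window n → ℝ) (f : ℤ → ℂ) (j : ℤ) :
    (grad (conv f u) j).re = grad (conv (fun i => (f i).re) u) j := by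
  simp [grad, conv]

theorem im_grad_conv (u : Window n → ℝ) (f : ℤ → ℂ) (j : ℤ) :
    (grad (conv f u) j).im = grad (conv (fun i => (f i).im) u) j := by
  simp [grad, conv]

-- A real kernel acts on real and imaginary parts separately, so real test functions suffice.
theorem sum_norm_sq_grad_conv_complex_le (𝕜 : Type*) [RCLike 𝕜] (u : Window n → ℝ) (f : ℤ → ℂ)
    (M : ℕ) :
    ∑ j ∈ Finset.Ico (0 : ℤ) M, ‖grad (conv f u) j‖ ^ 2 ≤
      ‖gradConvCLM 𝕜 u‖ ^ 2 * ∑ j ∈ Finset.Ico (-n : ℤ) (M + n + 1), ‖f j‖ ^ 2 := by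
  have hre := sum_norm_sq_grad_conv_le u (fun j => ((f j).re : 𝕜)) M
  have him := sum_norm_sq_grad_conv_le u (fun j => ((f j).im : 𝕜)) M
  simp only [grad_conv_ofReal, RCLike.norm_ofReal, sq_abs] at hre him
  simp only [Complex.sq_norm, Complex.normSq_apply, re_grad_conv, im_grad_conv, ← sq,
    Finset.sum_add_distrib, mul_add]
  exact add_le_add hre him

theorem grad_conv_zpow (u : Window n → ℝ) {z : ℂ} (hz : z ≠ 0) (j : ℤ) :
    grad (conv (fun i => z ^ i) u) j = (z - 1) * symbol u z * z ^ j := by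
  have hconv : ∀ i, conv (fun i => z ^ i) u i = symbol u z * z ^ i := by
    intro i
    simp only [conv, symbol, Finset.sum_mul, sub_eq_add_neg i, zpow_add₀ hz]
    refine Finset.sum_congr rfl fun k _ => ?_
    rw [RCLike.ofReal_eq_complex_ofReal]
    ring
  rw [grad, hconv, hconv, zpow_add_one₀ hz]
  ring

theorem norm_sub_one_mul_symbol_le_opNorm (𝕜 : Type*) [RCLike 𝕜] (u : Window n → ℝ) {z : ℂ}
    (hz : ‖z‖ = 1) : ‖(z - 1) * symbol u z‖ ≤ ‖gradConvCLM 𝕜 u‖ := by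
  set a := ‖(z - 1) * symbol u z‖
  set c := ‖gradConvCLM 𝕜 u‖
  have hz0 : z ≠ 0 := norm_ne_zero_iff.mp (hz ▸ one_ne_zero)
  have hgrad : ∀ j, ‖grad (conv (fun i => z ^ i) u) j‖ = a := fun j => by
    rw [grad_conv_zpow u hz0, norm_mul, norm_zpow, hz, one_zpow, mul_one]
  have hsum : ∀ M : ℕ, M * a ^ 2 ≤ c ^ 2 * (M + (2 * n + 1)) := by
    intro M
    have h := sum_norm_sq_grad_conv_complex_le 𝕜 u (fun j => z ^ j) M
    have hcard : ((M : ℤ) + n + 1 - -n).toNat = M + (2 * n + 1) := by omega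
    simp only [hgrad, norm_zpow, hz, one_zpow, one_pow, Finset.sum_const, Int.card_Ico, hcard,
      sub_zero, Int.toNat_natCast, nsmul_eq_mul, mul_one] at h
    exact_mod_cast h
  refine le_of_sq_le_sq ?_ (norm_nonneg _)
  by_contra! hlt
  obtain ⟨M, hM⟩ := exists_nat_gt (c ^ 2 * (2 * n + 1) / (a ^ 2 - c ^ 2))
  rw [div_lt_iff₀ (sub_pos.mpr hlt)] at hM
  linarith [hsum M]

end Operator

end SmoothAveraging

open SmoothAveraging in
theorem theorem1_general (𝕜 : Type*) [RCLike 𝕜] (n : ℕ) (u : Window n → ℝ) (hsum : ∑ k, u k = 1) :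
    BddAbove (ratios 𝕜 u) ∧
    2 / (2 * (n : ℝ) + 1) ≤ sSup (ratios 𝕜 u) ∧
    (sSup (ratios 𝕜 u) = 2 / (2 * (n : ℝ) + 1) ↔ ∀ k, u k = 1 / (2 * (n : ℝ) + 1)) := by
  have hLUB := isLUB_ratios (𝕜 := 𝕜) u
  have hsymbol (z : ℂ) (hz : ‖z‖ = 1) := norm_sub_one_mul_symbol_le_opNorm 𝕜 u hz
  have hlower : 2 / (2 * (n : ℝ) + 1) ≤ ‖gradConvCLM 𝕜 u‖ :=
    le_of_forall_gt_imp_ge_of_dense fun c hc =>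
      two_div_le_of_norm_sub_one_mul_symbol_le hsum ((norm_nonneg _).trans_lt hc) fun z hz =>
        (hsymbol z hz).trans hc.le
  rw [hLUB.csSup_eq (nonempty_ratios u)]
  refine ⟨hLUB.bddAbove, hlower, fun heq => ?_, fun hu => hlower.antisymm' ?_⟩
  · exact eq_const_of_symbol_eq_zero hsum fun z hz hz1 =>
      symbol_eq_zero_of_norm_sub_one_mul_symbol_le hsum (fun z hz => heq ▸ hsymbol z hz) hz hz1
  · refine (norm_gradConvCLM_le_of_const hu).trans_eq ?_
    rw [abs_of_nonneg (by positivity), mul_one_div]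

theorem theorem1 (𝕜 : Type*) [RCLike 𝕜] (n : ℕ) (u : SmoothAveraging.Window n → ℝ)
    (hsymm : SmoothAveraging.IsSymmetric u) (hsum : ∑ k, u k = 1) :
    BddAbove (SmoothAveraging.ratios 𝕜 u) ∧
    2 / (2 * (n : ℝ) + 1) ≤ sSup (SmoothAveraging.ratios 𝕜 u) ∧
    (sSup (SmoothAveraging.ratios 𝕜 u) = 2 / (2 * (n : ℝ) + 1) ↔
      ∀ k, u k = 1 / (2 * (n : ℝ) + 1)) :=
  theorem1_general 𝕜 n u hsum
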